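/- **Theorem 3.6.** All rings are commutative with one. A ring homomorphism $A\to B$ is *crisp* if $M\to M\otimes_A B$ is injective for every $A$-module $M$. A morphism of schemes $f\colon X\to Y$ is *locally quasi-compact surjective* if it is surjective and every quasi-compact open subset of $Y$ is the image of a quasi-compact open subset of $X$. A morphism of schemes $f\colon X\to Y$ is *crisp* if it is locally quasi-compact surjective and for every affine open $V\subseteq Y$ there are a quasi-compact open $U\subseteq f^{-1}(V)$ with $f(U)=V$ and a finite covering $U=U_1\cup\dots\cup U_r$ by affine opens such that the ring homomorphism $\Gamma(V,\mathcal O_Y)\to\prod_{i=1}^r\Gamma(U_i,\mathcal O_X)$ corresponding to $\bigsqcup_i U_i\to V$ is crisp. Let $S$ be a scheme. Call a small family $\{U_i\to U\}_{i\in I}$ of morphisms in $(\mathrm{Sch}/S)$ a *crisp covering* if the induced morphism $\bigsqcup_i U_i\to U$ is crisp, and an *fpqc covering* if $\bigsqcup_i U_i\to U$ is flat and locally quasi-compact surjective. Then: 1. The crisp coverings form a Grothendieck pretopology on $(\mathrm{Sch}/S)$: isomorphisms are coverings, and coverings are stable under base change and under composition. Whether a family is a crisp covering depends only on its set of arrows.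 2. Every fpqc covering is a crisp covering; hence the crisp topology is finer than the fpqc topology. 3. The crisp topology is subcanonical: every representable functor $(\mathrm{Sch}/S)^{\mathrm{op}}\to(\mathrm{Set})$ is a sheaf for the crisp topology. -/

import Mathlib

open CategoryTheory CategoryTheory.Limits AlgebraicGeometry
open scoped TensorProduct

universe u

/-- An `A`-linear map `g : M → N` is *crisp* (also called pure, or universally injective) if
`g ⊗ id_P : M ⊗ P → N ⊗ P` is injective for every `A`-module `P`. -/
def IsCrispLinearMap {A M N : Type u} [CommRing A] [AddCommGroup M] [AddCommGroup N]
    [Module A M] [Module A N] (g : M →ₗ[A] N) : Prop :=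
  ∀ (P : Type u) [AddCommGroup P] [Module A P], Function.Injective (g.rTensor P)

/-- A ring homomorphism `φ : A → B` is *crisp* if it is crisp as an `A`-linear map, where `B` is an
`A`-module through `φ`. -/
def IsCrispRingHom {A B : Type u} [CommRing A] [CommRing B] (φ : A →+* B) : Prop :=
  letI : Algebra A B := φ.toAlgebra
  IsCrispLinearMap (Algebra.linearMap A B)

/-- A morphism of schemes is *locally quasi-compact surjective* if it is surjective and every
quasi-compact open of the target is the image of a quasi-compact open of the source. -/
structure IsLocallyQuasiCompactSurjective {X Y : Scheme.{u}} (f : X ⟶ Y) : Prop where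
  surjective : Function.Surjective f
  exists_isCompact : ∀ V : Y.Opens, IsCompact (V : Set Y) →
    ∃ U : X.Opens, IsCompact (U : Set X) ∧ f '' (U : Set X) = (V : Set Y)

/-- A morphism of schemes `f : X ⟶ Y` is *crisp* if it is locally quasi-compact surjective and for
every affine open `V` of `Y` there are a quasi-compact open `U ⊆ f⁻¹(V)` with `f(U) = V` and a
finite covering of `U` by affine opens `W₁, …, Wᵣ` such that the ring homomorphism
`Γ(Y, V) → ∏ᵢ Γ(X, Wᵢ)`, which corresponds to the morphism of affine schemes `∐ᵢ Wᵢ ⟶ V` from the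
disjoint union, is crisp. -/
structure IsCrisp {X Y : Scheme.{u}} (f : X ⟶ Y) : Prop where
  locallyQuasiCompactSurjective : IsLocallyQuasiCompactSurjective f
  exists_cover : ∀ V : Y.Opens, IsAffineOpen V →
    ∃ U : X.Opens, IsCompact (U : Set X) ∧ U ≤ f ⁻¹ᵁ V ∧ f '' (U : Set X) = (V : Set Y) ∧
      ∃ (r : ℕ) (W : Fin r → X.Opens) (hW : ∀ i, W i ≤ f ⁻¹ᵁ V),
        (∀ i, IsAffineOpen (W i)) ∧ ⨆ i, W i = U ∧
          IsCrispRingHom (RingHom.pi fun i => (f.appLE V (W i) (hW i)).hom)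

/-- The morphism `∐ᵢ Uᵢ ⟶ X` of schemes induced by a family of morphisms `Uᵢ ⟶ X` over `S`. -/
noncomputable def inducedMap {S : Scheme.{u}} {X : Over S} {ι : Type u} {U : ι → Over S}
    (f : ∀ i, U i ⟶ X) : (∐ fun i => (U i).left) ⟶ X.left :=
  Sigma.desc fun i => (f i).left

/-- The family `{Uᵢ ⟶ X}` is a crisp covering: the induced morphism `∐ᵢ Uᵢ ⟶ X` is crisp. -/
def IsCrispFamily {S : Scheme.{u}} {X : Over S} {ι : Type u} {U : ι → Over S}
    (f : ∀ i, U i ⟶ X) : Prop :=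
  IsCrisp (inducedMap f)

/-- The family `{Uᵢ ⟶ X}` is an fpqc covering: the induced morphism `∐ᵢ Uᵢ ⟶ X` is faithfully flat
(flat and surjective) and locally quasi-compact surjective. -/
def IsFpqcFamily {S : Scheme.{u}} {X : Over S} {ι : Type u} {U : ι → Over S}
    (f : ∀ i, U i ⟶ X) : Prop :=
  Flat (inducedMap f) ∧ IsLocallyQuasiCompactSurjective (inducedMap f)

/-- The sets of arrows in `(Sch/S)` that are given by (small) crisp coverings. -/
def crispPrecoverage (S : Scheme.{u}) : Precoverage (Over S) where
  coverings X := {R | ∃ (ι : Type u) (U : ι → Over S) (f : ∀ i, U i ⟶ X),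
    R = Presieve.ofArrows U f ∧ IsCrispFamily f}

/-- The sets of arrows in `(Sch/S)` that are given by (small) fpqc coverings. -/
def fpqcPrecoverage (S : Scheme.{u}) : Precoverage (Over S) where
  coverings X := {R | ∃ (ι : Type u) (U : ι → Over S) (f : ∀ i, U i ⟶ X),
    R = Presieve.ofArrows U f ∧ IsFpqcFamily f}

-- A ring map `A → B` is crisp exactly when `P → B ⊗ P` is injective for every `P`. Asking this
-- jointly of a family `A → Bᵢ` gives a condition visibly stable under composition, base change and
-- refinement; for finite families it is crispness of `A → ∏ Bᵢ`.
--
-- These families define `crispTopology` on all schemes, whose axioms are then formal. The link with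
-- the geometric definition is `isCrisp_iff_mem_crispTopology`: a morphism is crisp if and only if
-- the sieve it generates is covering. Affine opens and quasi-compact images enter only there, and
-- the pretopology axioms over `S` are inherited from the topology. An fpqc covering is crisp
-- because, over an affine open, finitely many affine opens upstairs already give a faithfully flat
-- ring map.
--
-- Subcanonicity is descent. If `A → B` is crisp, `A` is the equalizer of `B ⇉ B ⊗ B`, and `Spec B →
-- Spec A` is a topological quotient map because ideals contract and specializations lift. A
-- morphism out of `Spec B` equalizing the two projections therefore descends as a continuous map,
-- then locally on affine targets, and the local descents glue
-- (`IsCrispRingHom.isRegularEpi_of_isAffine`). Zariski descent handles finite families and general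
-- schemes.

universe v

/-! ### Crisp ring homomorphisms and jointly crisp families -/

section Algebra

/-- The element `1 ⊗ p` of `B ⊗ P` vanishes, where `B` is an `A`-module through `φ : A → B`. -/
def TensorVanishes {A B P : Type u} [CommRing A] [CommRing B] [AddCommGroup P] [Module A P]
    (φ : A →+* B) (p : P) : Prop :=
  letI : Algebra A B := φ.toAlgebra
  (1 : B) ⊗ₜ[A] p = 0

/-- A family of ring homomorphisms `φᵢ : A → Bᵢ` is *jointly crisp* if for every `A`-module `P`
the maps `P → Bᵢ ⊗ P` are jointly injective. -/
def IsJointlyCrisp {A : Type u} [CommRing A] {ι : Type*} {B : ι → Type u}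
    [∀ i, CommRing (B i)] (φ : ∀ i, A →+* B i) : Prop :=
  ∀ (P : Type u) [AddCommGroup P] [Module A P] (p : P), (∀ i, TensorVanishes (φ i) p) → p = 0

variable {A B C P : Type u} [CommRing A] [CommRing B] [CommRing C] [AddCommGroup P] [Module A P]

lemma tensorVanishes_algebraMap_iff [Algebra A B] (p : P) :
    TensorVanishes (algebraMap A B) p ↔ (1 : B) ⊗ₜ[A] p = 0 := by
  have : (algebraMap A B).toAlgebra = ‹Algebra A B› := Algebra.algebra_ext _ _ fun _ ↦ rfl
  change (letI := (algebraMap A B).toAlgebra; (1 : B) ⊗ₜ[A] p = 0) ↔ _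
  rw [this]

lemma TensorVanishes.comp {φ : A →+* B} {p : P} (h : TensorVanishes φ p) (ψ : B →+* C) :
    TensorVanishes (ψ.comp φ) p := by
  algebraize [φ, ψ, ψ.comp φ]
  replace h : (1 : B) ⊗ₜ[A] p = 0 := h
  change (1 : C) ⊗ₜ[A] p = 0
  simpa using congr((IsScalarTower.toAlgHom A B C).toLinearMap.rTensor P $h)

/-- Vanishing of `1 ⊗ p` after extension along a composition, in two steps. -/
lemma TensorVanishes.of_comp {φ : A →+* B} {ψ : B →+* C} {p : P}
    (h : TensorVanishes (ψ.comp φ) p) :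
    letI : Algebra A B := φ.toAlgebra
    TensorVanishes ψ ((1 : B) ⊗ₜ[A] p) := by
  algebraize [φ, ψ, ψ.comp φ]
  replace h : (1 : C) ⊗ₜ[A] p = 0 := h
  change (1 : C) ⊗ₜ[B] ((1 : B) ⊗ₜ[A] p) = 0
  apply (TensorProduct.AlgebraTensorModule.cancelBaseChange A B C C P).injective
  simpa using h

/-- Since `(A' ⊗[A] B) ⊗[A'] P ≅ B ⊗[A] P`, crispness over `A'` can be tested by restricting scalars
to `A`. -/
lemma TensorVanishes.of_includeLeft {A' : Type u} [CommRing A'] [Algebra A A'] [Algebra A B]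
    [Module A' P] [IsScalarTower A A' P] {p : P}
    (h : TensorVanishes (algebraMap A' (A' ⊗[A] B)) p) : (1 : B) ⊗ₜ[A] p = 0 := by
  rw [tensorVanishes_algebraMap_iff] at h
  apply (TensorProduct.comm A B P).injective
  have := congr(TensorProduct.AlgebraTensorModule.cancelBaseChange A A' A' P B
    (TensorProduct.comm A' _ P $h))
  simpa [Algebra.TensorProduct.one_def] using this

lemma isCrispRingHom_iff (φ : A →+* B) :
    IsCrispRingHom φ ↔ ∀ (P : Type u) [AddCommGroup P] [Module A P] (p : P),
      TensorVanishes φ p → p = 0 := by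
  algebraize [φ]
  change (∀ (P : Type u) [AddCommGroup P] [Module A P],
    Function.Injective ((Algebra.linearMap A B).rTensor P)) ↔ _
  refine forall_congr' fun P ↦ forall_congr' fun _ ↦ forall_congr' fun _ ↦ ?_
  rw [injective_iff_map_eq_zero]
  refine ⟨fun h p hp ↦ ?_, fun h x hx ↦ ?_⟩
  · replace hp : (1 : B) ⊗ₜ[A] p = 0 := hp
    simpa using h ((1 : A) ⊗ₜ p) (by simpa using hp)
  · obtain ⟨p, rfl⟩ := (TensorProduct.lid A P).symm.surjective x
    have := h p (by change (1 : B) ⊗ₜ[A] p = 0; simpa using hx)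
    simp [this]

section Family

variable {ι κ : Type*} {B : ι → Type u} [∀ i, CommRing (B i)] {φ : ∀ i, A →+* B i}

/-- Jointly crisp families are stable under factorization. -/
lemma IsJointlyCrisp.of_factors {B' : κ → Type u} [∀ k, CommRing (B' k)] {ψ : ∀ k, A →+* B' k}
    (h : IsJointlyCrisp φ) (H : ∀ i, ∃ k, ∃ g : B' k →+* B i, g.comp (ψ k) = φ i) :
    IsJointlyCrisp ψ := by
  intro P _ _ p hp
  refine h P p fun i ↦ ?_
  obtain ⟨k, g, hg⟩ := H i
  rw [← hg]
  exact (hp k).comp g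

/-- Jointly crisp families are stable under composition. -/
lemma IsJointlyCrisp.comp {κ : ι → Type*} {C : ∀ i, κ i → Type u} [∀ i k, CommRing (C i k)]
    {ψ : ∀ i k, B i →+* C i k} (h : IsJointlyCrisp φ) (H : ∀ i, IsJointlyCrisp (ψ i)) :
    IsJointlyCrisp (fun j : Σ i, κ i ↦ (ψ j.1 j.2).comp (φ j.1)) := by
  intro P _ _ p hp
  refine h P p fun i ↦ ?_
  algebraize [φ i]
  change (1 : B i) ⊗ₜ[A] p = 0
  refine H i (B i ⊗[A] P) _ fun k ↦ ?_
  exact TensorVanishes.of_comp (hp ⟨i, k⟩)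

/-- Jointly crisp families are stable under base change. -/
lemma IsJointlyCrisp.baseChange [∀ i, Algebra A (B i)]
    (h : IsJointlyCrisp fun i ↦ algebraMap A (B i)) (A' : Type u) [CommRing A'] [Algebra A A'] :
    IsJointlyCrisp fun i ↦ algebraMap A' (A' ⊗[A] B i) := by
  intro P _ _ p hp
  let : Module A P := Module.compHom P (algebraMap A A')
  have : IsScalarTower A A' P := ⟨fun a b c ↦ by
    rw [Algebra.smul_def, mul_smul]; rfl⟩
  refine h P p fun i ↦ ?_
  rw [tensorVanishes_algebraMap_iff]
  exact (hp i).of_includeLeft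

lemma isJointlyCrisp_id : IsJointlyCrisp fun _ : PUnit.{u + 1} ↦ RingHom.id A := by
  intro P _ _ p hp
  have := congr(TensorProduct.lid A P $((tensorVanishes_algebraMap_iff p).mp (hp ⟨⟩)))
  simpa using this

end Family

/-- Tensor products commute with finite products, so vanishing in `(∏ Bᵢ) ⊗ P` is tested
componentwise. -/
lemma isCrispRingHom_pi_iff {ι : Type v} [Finite ι] {A : Type (max u v)} [CommRing A]
    {B : ι → Type (max u v)} [∀ i, CommRing (B i)] (φ : ∀ i, A →+* B i) :
    IsCrispRingHom (RingHom.pi φ) ↔ IsJointlyCrisp φ := by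
  rw [isCrispRingHom_iff]
  refine forall_congr' fun P ↦ forall_congr' fun _ ↦ forall_congr' fun _ ↦ forall_congr' fun p ↦ ?_
  suffices TensorVanishes (RingHom.pi φ) p ↔ ∀ i, TensorVanishes (φ i) p by rw [this]
  refine ⟨fun h i ↦ h.comp (Pi.evalRingHom B i), fun h ↦ ?_⟩
  cases nonempty_fintype ι
  classical
  let (i : ι) : Algebra A (B i) := (φ i).toAlgebra
  have : RingHom.pi φ = algebraMap A (∀ i, B i) := rfl
  rw [this, tensorVanishes_algebraMap_iff]
  apply (TensorProduct.comm A _ P).injective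
  apply (TensorProduct.piRight A A P B).injective
  ext i
  have hi : (1 : B i) ⊗ₜ[A] p = 0 := h i
  simpa using congr(TensorProduct.comm A _ P $hi)

lemma isCrispRingHom_iff_isJointlyCrisp (φ : A →+* B) :
    IsCrispRingHom φ ↔ IsJointlyCrisp fun _ : PUnit.{1} ↦ φ := by
  simp [isCrispRingHom_iff, IsJointlyCrisp]

lemma RingHom.FaithfullyFlat.isCrispRingHom {φ : A →+* B} (h : φ.FaithfullyFlat) :
    IsCrispRingHom φ := by
  rw [isCrispRingHom_iff]
  intro P _ _ p hp
  algebraize [φ]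
  exact Module.FaithfullyFlat.tensorProduct_mk_injective (A := A) (B := B) P
    (by simpa using (show (1 : B) ⊗ₜ[A] p = 0 from hp))

lemma IsCrispRingHom.comp {φ : A →+* B} {ψ : B →+* C} (hφ : IsCrispRingHom φ)
    (hψ : IsCrispRingHom ψ) : IsCrispRingHom (ψ.comp φ) := by
  rw [isCrispRingHom_iff] at *
  intro P _ _ p hp
  refine hφ P p ?_
  algebraize [φ]
  exact hψ _ _ hp.of_comp

lemma isCrispRingHom_of_bijective (φ : A →+* B) (h : Function.Bijective φ) : IsCrispRingHom φ :=
  RingHom.FaithfullyFlat.isCrispRingHom (.of_bijective h)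

lemma isCrispRingHom_respectsIso : RingHom.RespectsIso @IsCrispRingHom.{u} :=
  RingHom.StableUnderComposition.respectsIso (fun _ _ _ _ _ _ _ _ h h' ↦ h.comp h')
    fun e ↦ isCrispRingHom_of_bijective _ e.bijective

lemma isCrispRingHom_isStableUnderBaseChange :
    RingHom.IsStableUnderBaseChange @IsCrispRingHom.{u} := by
  refine .mk isCrispRingHom_respectsIso fun R S T _ _ _ _ _ h ↦ ?_
  rw [isCrispRingHom_iff_isJointlyCrisp] at h ⊢
  exact IsJointlyCrisp.baseChange (B := fun _ : PUnit.{1} ↦ T) h S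

lemma IsCrispRingHom.injective {φ : A →+* B} (h : IsCrispRingHom φ) : Function.Injective φ := by
  rw [isCrispRingHom_iff] at h
  rw [injective_iff_map_eq_zero]
  intro a ha
  refine h A a ?_
  algebraize [φ]
  change (1 : B) ⊗ₜ[A] a = 0
  apply (TensorProduct.rid A B).injective
  simpa [Algebra.smul_def, RingHom.algebraMap_toAlgebra] using ha

/-- Ideals are contracted along a crisp ring homomorphism. -/
lemma IsCrispRingHom.comap_map {φ : A →+* B} (h : IsCrispRingHom φ) (I : Ideal A) :
    (I.map φ).comap φ = I := by
  refine le_antisymm (fun a ha ↦ ?_) Ideal.le_comap_map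
  rw [isCrispRingHom_iff] at h
  rw [← Ideal.Quotient.eq_zero_iff_mem]
  refine h (A ⧸ I) _ ?_
  algebraize [φ]
  change (1 : B) ⊗ₜ[A] (Ideal.Quotient.mk I a) = 0
  have key (x : A) : φ x ⊗ₜ[A] (1 : A ⧸ I) = (1 : B) ⊗ₜ[A] Ideal.Quotient.mk I x := by
    have h1 : φ x = x • (1 : B) := by rw [Algebra.smul_def, mul_one]; rfl
    have h2 : Ideal.Quotient.mk I x = x • (1 : A ⧸ I) := by
      rw [Algebra.smul_def, mul_one]; rfl
    rw [h1, h2, TensorProduct.smul_tmul]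
  have hI : I.map φ ≤ LinearMap.ker
      ((TensorProduct.AlgebraTensorModule.mk A B B (A ⧸ I)).flip 1) := by
    rw [Ideal.map_le_iff_le_comap]
    intro x hx
    change φ x ⊗ₜ[A] (1 : A ⧸ I) = 0
    rw [key, Ideal.Quotient.eq_zero_iff_mem.mpr hx, TensorProduct.tmul_zero]
  rw [← key]
  exact hI ha

/-- Crispness is tested on the cokernel of `A → B`: there `1 ⊗ [b] = b ⊗ [1] = 0`, hence `[b] = 0`.
-/
lemma IsCrispRingHom.mem_range_of_tmul_eq [Algebra A B] (h : IsCrispRingHom (algebraMap A B))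
    {b : B} (hb : b ⊗ₜ[A] (1 : B) = 1 ⊗ₜ b) : b ∈ Set.range (algebraMap A B) := by
  rw [isCrispRingHom_iff] at h
  let R := LinearMap.range (Algebra.linearMap A B)
  have : R.mkQ b = 0 := by
    refine h (B ⧸ R) _ ?_
    rw [tensorVanishes_algebraMap_iff]
    have h1 : R.mkQ 1 = 0 := (Submodule.Quotient.mk_eq_zero _).mpr ⟨1, by simp⟩
    simpa [h1] using congr(R.mkQ.lTensor B $hb.symm)
  exact (Submodule.Quotient.mk_eq_zero _).mp this

end Algebra

/-! ### Lifting specializations and the quotient topology -/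

section Topology

variable {A B : Type u} [CommRing A] [CommRing B]

/-- The preimage in `B` of the torsion of `B / pB` over `A / p`. -/
def torsionPreimage (φ : A →+* B) (p : Ideal A) [p.IsPrime] : Ideal B where
  carrier := {b | ∃ a ∉ p, φ a * b ∈ p.map φ}
  zero_mem' := ⟨1, p.one_notMem, by simp⟩
  add_mem' := by
    rintro x y ⟨a, ha, hx⟩ ⟨b, hb, hy⟩
    refine ⟨a * b, ‹p.IsPrime›.mul_notMem ha hb, ?_⟩
    have : φ (a * b) * (x + y) = φ b * (φ a * x) + φ a * (φ b * y) := by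
      rw [map_mul]; ring
    rw [this]
    exact add_mem (Ideal.mul_mem_left _ _ hx) (Ideal.mul_mem_left _ _ hy)
  smul_mem' := by
    rintro c x ⟨a, ha, hx⟩
    refine ⟨a, ha, ?_⟩
    rw [smul_eq_mul, mul_left_comm]
    exact Ideal.mul_mem_left _ _ hx

lemma map_le_torsionPreimage (φ : A →+* B) (p : Ideal A) [p.IsPrime] :
    p.map φ ≤ torsionPreimage φ p :=
  fun b hb ↦ ⟨1, p.one_notMem, by simpa using hb⟩

lemma mem_torsionPreimage_of_mul_mem {φ : A →+* B} {p : Ideal A} [p.IsPrime] {a : A} (ha : a ∉ p)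
    {b : B} (h : φ a * b ∈ torsionPreimage φ p) : b ∈ torsionPreimage φ p := by
  obtain ⟨c, hc, h⟩ := h
  refine ⟨c * a, ‹p.IsPrime›.mul_notMem hc ha, ?_⟩
  rwa [map_mul, mul_assoc]

/-- If `φ s = t + y` with `φ a * t ∈ pB`, `a ∉ p` and `y ∈ p'B`, then `φ (a * s)` lies in the
extension of `p + a p'`. Contraction gives `a * (s - m) ∈ p` for some `m ∈ p'`, so `s - m ∈ p ≤ p'`
and `s ∈ p'`. -/
lemma IsCrispRingHom.disjoint_torsionPreimage {φ : A →+* B} (h : IsCrispRingHom φ)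
    {p p' : Ideal A} [p.IsPrime] [p'.IsPrime] (hpp' : p ≤ p') :
    Disjoint ((torsionPreimage φ p ⊔ p'.map φ : Ideal B) : Set B)
      (p'.primeCompl.map φ : Submonoid B) := by
  rw [Set.disjoint_left]
  rintro _ hs ⟨s, hs', rfl⟩
  obtain ⟨t, ⟨a, ha, ht⟩, y, hy, hty⟩ := Submodule.mem_sup.mp hs
  have hmem : a * s ∈ ((p ⊔ Ideal.span {a} * p').map φ).comap φ := by
    rw [Ideal.mem_comap, map_mul, ← hty, mul_add, Ideal.map_sup, Ideal.map_mul, Ideal.map_span,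
      Set.image_singleton]
    exact Submodule.add_mem_sup ht (Ideal.mul_mem_mul (Ideal.mem_span_singleton_self _) hy)
  rw [h.comap_map] at hmem
  obtain ⟨x, hx, z, hz, hxz⟩ := Submodule.mem_sup.mp hmem
  obtain ⟨m, hm, rfl⟩ := Ideal.mem_span_singleton_mul.mp hz
  have : a * (s - m) ∈ p := by
    have : a * (s - m) = x := by rw [mul_sub, ← hxz]; ring
    rwa [this]
  have := hpp' ((‹p.IsPrime›.mem_or_mem this).resolve_left ha)
  exact hs' (by simpa using add_mem this hm)

/-- Specializations lift along a crisp ring homomorphism. -/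
lemma IsCrispRingHom.exists_le_of_le {φ : A →+* B} (h : IsCrispRingHom φ)
    {p p' : PrimeSpectrum A} (hpp' : p ≤ p') :
    ∃ q q' : PrimeSpectrum B, q ≤ q' ∧ q.comap φ = p ∧ q'.comap φ = p' := by
  -- Making `q'` contain the torsion ideal, and not only `p'B`, leaves room for a smaller prime over
  -- `p`.
  obtain ⟨q', hq', hle', hd'⟩ := Ideal.exists_le_prime_disjoint _ _
    (h.disjoint_torsionPreimage (p := p.asIdeal) (p' := p'.asIdeal) hpp')
  -- A prime avoiding this product of multiplicative sets lies inside `q'` and contracts into `p`.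
  have hd : Disjoint (torsionPreimage φ p.asIdeal : Set B)
      (p.asIdeal.primeCompl.map φ ⊔ q'.primeCompl : Submonoid B) := by
    rw [Set.disjoint_left]
    intro b hb hb'
    obtain ⟨_, ⟨a, ha, rfl⟩, t, ht, rfl⟩ := Submonoid.mem_sup.mp hb'
    exact ht (hle' (le_sup_left (α := Ideal B) (mem_torsionPreimage_of_mul_mem ha hb)))
  obtain ⟨q, hq, hle, hd⟩ := Ideal.exists_le_prime_disjoint _ _ hd
  refine ⟨⟨q, hq⟩, ⟨q', hq'⟩, fun b hb ↦ ?_, ?_, ?_⟩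
  · by_contra hbq
    exact Set.disjoint_left.mp hd hb
      ((le_sup_right : _ ≤ p.asIdeal.primeCompl.map φ ⊔ q'.primeCompl) hbq)
  · ext a
    refine ⟨fun ha ↦ ?_, fun ha ↦ hle (map_le_torsionPreimage _ _ (Ideal.mem_map_of_mem _ ha))⟩
    by_contra hap
    exact Set.disjoint_left.mp hd ha
      ((le_sup_left : _ ≤ p.asIdeal.primeCompl.map φ ⊔ q'.primeCompl) ⟨a, hap, rfl⟩)
  · ext a
    refine ⟨fun ha ↦ ?_, fun ha ↦ hle' (le_sup_right (α := Ideal B) (Ideal.mem_map_of_mem _ ha))⟩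
    by_contra hap
    exact Set.disjoint_left.mp hd' ha ⟨a, hap, rfl⟩

lemma IsCrispRingHom.comap_surjective {φ : A →+* B} (h : IsCrispRingHom φ) :
    Function.Surjective (PrimeSpectrum.comap φ) := fun p ↦
  have ⟨q, _, _, hq, _⟩ := h.exists_le_of_le (le_refl p)
  ⟨q, hq⟩

/-- A crisp ring homomorphism induces a topological quotient map on prime spectra. -/
lemma IsCrispRingHom.isQuotientMap_comap {φ : A →+* B} (h : IsCrispRingHom φ) :
    Topology.IsQuotientMap (PrimeSpectrum.comap φ) := by
  refine Topology.isQuotientMap_iff_isClosed.mpr ⟨h.comap_surjective, fun Z ↦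
    ⟨fun hZ ↦ hZ.preimage (PrimeSpectrum.continuous_comap φ), fun hZ ↦ ?_⟩⟩
  -- `Z` is the image of a closed set, so it is closed once it is stable under specialization.
  rw [← Set.image_preimage_eq Z h.comap_surjective]
  refine PrimeSpectrum.isClosed_image_of_stableUnderSpecialization _ _ hZ ?_
  rw [Set.image_preimage_eq Z h.comap_surjective]
  intro x y hxy hx
  obtain ⟨q, q', hqq', rfl, rfl⟩ :=
    h.exists_le_of_le ((PrimeSpectrum.le_iff_specializes _ _).mpr hxy)
  exact hZ.stableUnderSpecialization ((PrimeSpectrum.le_iff_specializes _ _).mp hqq') hx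

end Topology

/-! ### Descent of morphisms along crisp maps of affine schemes -/

section Descent

lemma IsCrispRingHom.isQuotientMap_of_isAffine {X Y : Scheme.{u}} [IsAffine X] [IsAffine Y]
    {π : X ⟶ Y} (hπ : IsCrispRingHom π.appTop.hom) : Topology.IsQuotientMap π := by
  have h : π = X.isoSpec.hom ≫ Spec.map π.appTop ≫ Y.isoSpec.inv := by
    rw [Scheme.isoSpec_inv_naturality, Iso.hom_inv_id_assoc]
  have h' : (π : X → Y) =
      Y.isoSpec.inv.homeomorph ∘ PrimeSpectrum.comap π.appTop.hom ∘ X.isoSpec.hom.homeomorph := by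
    conv_lhs => rw [h]
    rfl
  rw [h']
  exact (Y.isoSpec.inv.homeomorph.isQuotientMap.comp hπ.isQuotientMap_comap).comp
    X.isoSpec.hom.homeomorph.isQuotientMap

lemma IsCrispRingHom.surjective_of_isAffine {X Y : Scheme.{u}} [IsAffine X] [IsAffine Y]
    {π : X ⟶ Y} (hπ : IsCrispRingHom π.appTop.hom) : Surjective π :=
  ⟨hπ.isQuotientMap_of_isAffine.surjective⟩

/-- A crisp morphism of affine schemes is an epimorphism of schemes. -/
lemma IsCrispRingHom.epi_of_isAffine {X Y : Scheme.{u}} [IsAffine X] [IsAffine Y]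
    {π : X ⟶ Y} (hπ : IsCrispRingHom π.appTop.hom) : Epi π := by
  refine ⟨fun {Z} a b hab ↦ ?_⟩
  have hs := hπ.surjective_of_isAffine
  let l : X ⟶ equalizer a b := equalizer.lift π hab
  have hl : l ≫ equalizer.ι a b = π := equalizer.lift_ι _ _
  have hs' : Surjective (equalizer.ι a b) := by
    have : Surjective (l ≫ equalizer.ι a b) := hl ▸ hs
    exact .of_comp l _
  -- The equalizer of morphisms of schemes is an immersion in general; surjectivity makes it closed.
  -- Injectivity on global sections then makes it an isomorphism.
  have hc : IsClosedImmersion (equalizer.ι a b) :=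
    .of_isPreimmersion _ (by rw [hs'.surj.range_eq]; exact isClosed_univ)
  have hinj : Function.Injective (equalizer.ι a b).appTop := by
    have := hπ.injective
    rw [← hl, Scheme.Hom.comp_appTop, CommRingCat.hom_comp, RingHom.coe_comp] at this
    exact this.of_comp
  have : IsIso (equalizer.ι a b) :=
    IsClosedImmersion.isIso_of_injective_of_isAffine hinj
  rw [← cancel_epi (equalizer.ι a b)]
  exact equalizer.condition a b

open CommRingCat in
/-- A crisp ring homomorphism `R → S` is the equalizer of the two maps `S → S ⊗ S`. -/
lemma IsCrispRingHom.isRegularMono {R S : CommRingCat.{u}} (f : R ⟶ S) (hf : IsCrispRingHom f.hom) :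
    IsRegularMono f := by
  algebraize [f.hom]
  have hf' : IsCrispRingHom (algebraMap R S) := hf
  have heff : Algebra.IsEffective R S := fun s ↦
    ⟨fun hs ↦ hf'.mem_range_of_tmul_eq (sub_eq_zero.mp hs),
      Algebra.TensorProduct.includeLeftSubRight_zero_of_mem_range⟩
  have hbij : Function.Bijective (Algebra.codRestrictEqLocusPushoutCocone R S) :=
    ⟨RingHom.injective_codRestrict.mpr hf'.injective,
      Algebra.codRestrictEqLocusPushoutCocone.surjective_of_isEffective R S heff⟩
  let fork : Fork (pushoutCocone R S S).inl (pushoutCocone R S S).inr :=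
    Fork.ofι (ofHom (algebraMap R S)) (by rw [(PushoutCocone.condition _)])
  let isLimit : IsLimit fork :=
    (Fork.isLimitEquivOfIsos _
      (equalizerFork (pushoutCocone R S S).inl (pushoutCocone R S S).inr) (Iso.refl _) (Iso.refl _)
      (RingEquiv.toCommRingCatIso <| RingEquiv.ofBijective _ hbij)
      (by cat_disch) (by cat_disch) (by cat_disch)).symm
    (equalizerForkIsLimit (pushoutCocone R S S).inl (pushoutCocone R S S).inr)
  exact isRegularMono_of_regularMono ⟨_, _, _, _, isLimit⟩

lemma IsCrispRingHom.exists_comp_eq_of_isAffine {X Y S : Scheme.{u}} [IsAffine X] [IsAffine Y]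
    [IsAffine S] {π : X ⟶ Y} (hπ : IsCrispRingHom π.appTop.hom)
    (f : X ⟶ S) (hf : pullback.fst π π ≫ f = pullback.snd π π ≫ f) :
    ∃ u : Y ⟶ S, π ≫ u = f := by
  have : EffectiveEpi (AffineScheme.ofHom π) := by
    apply AffineScheme.equivCommRingCat.functor.effectiveEpi_of_map
    rw [← isRegularEpi_iff_effectiveEpi]
    exact (isRegularEpi_op_iff_isRegularMono _).mpr hπ.isRegularMono
  obtain ⟨u, hu⟩ := IsRegularEpi.exists_of_isKernelPair
    (AffineScheme.ofHom π)
    (IsPullback.of_map (f := AffineScheme.ofHom (pullback.fst π π)) (AffineScheme.forgetToScheme)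
      (InducedCategory.Hom.ext pullback.condition) (.of_hasPullback _ _))
    (AffineScheme.ofHom f) (InducedCategory.Hom.ext hf)
  use u.hom, InducedCategory.Hom.ext_iff.mp hu

lemma IsCrispRingHom.pullback_snd_appTop {X Y Y' : Scheme.{u}} [IsAffine X] [IsAffine Y]
    [IsAffine Y'] {π : X ⟶ Y} (hπ : IsCrispRingHom π.appTop.hom) (g : Y' ⟶ Y) :
    IsCrispRingHom (pullback.snd π g).appTop.hom := by
  have := isCrispRingHom_isStableUnderBaseChange.pullback_fst_appTop _
    isCrispRingHom_respectsIso g π hπ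
  rw [← pullbackSymmetry_hom_comp_fst, Scheme.Hom.comp_appTop, CommRingCat.hom_comp]
  have : IsIso (pullbackSymmetry π g).hom.appTop := by
    change IsIso (Scheme.Γ.map (pullbackSymmetry π g).hom.op)
    infer_instance
  exact (isCrispRingHom_respectsIso.cancel_right_isIso _ _).mpr ‹_›

/-- The quotient topology yields a continuous `Y → S` through which `f` factors. Affine opens of `Y`
mapping into affine opens of `S` reduce the problem to affine descent. -/
lemma IsCrispRingHom.exists_openCover_exists {X Y S : Scheme.{u}} [IsAffine X] [IsAffine Y]
    {π : X ⟶ Y} (hπ : IsCrispRingHom π.appTop.hom)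
    (f : X ⟶ S) (hf : pullback.fst π π ≫ f = pullback.snd π π ≫ f) :
    ∃ (𝒰 : Scheme.OpenCover.{u} Y),
      ∀ i : 𝒰.I₀, ∃ (u : 𝒰.X i ⟶ S), pullback.fst π (𝒰.f i) ≫ f = pullback.snd _ _ ≫ u := by
  have hs := hπ.surjective_of_isAffine
  obtain ⟨b, hfac⟩ : ∃ (u : Y.carrier ⟶ S.carrier), π.base ≫ u = f.base := by
    have : EffectiveEpi π.base := by
      rw [TopCat.effectiveEpi_iff_isQuotientMap]
      exact hπ.isQuotientMap_of_isAffine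
    apply IsRegularEpi.exists_of_isKernelPair _ (IsPullback.of_hasPullback _ _)
    -- The fibre product of schemes maps onto that of spaces, so `hf` passes to the topological
    -- kernel pair.
    have := congr(Scheme.forgetToTop.map $hf)
    rwa [Functor.map_comp, Functor.map_comp, ← pullbackComparison_comp_fst_assoc,
      ← pullbackComparison_comp_snd_assoc, cancel_epi] at this
  let 𝒰 := Y.openCoverOfIsOpenCover _ <| Y.isBasis_affineOpens.isOpenCover_mem_and_le
    (S.isBasis_affineOpens.isOpenCover.comap b.hom)
  refine ⟨𝒰, fun i ↦ ?_⟩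
  have : IsAffine (𝒰.X i) := i.2.1
  let f' : pullback π (𝒰.f i) ⟶ i.1.2.1 := by
    apply IsOpenImmersion.lift (Scheme.Opens.ι i.1.2.1) (pullback.fst _ _ ≫ f)
    rw [Scheme.Opens.range_ι]
    rintro _ ⟨x, rfl⟩
    have h1 : f (pullback.fst π (𝒰.f i) x) = b (π (pullback.fst π (𝒰.f i) x)) :=
      congr($hfac.symm (pullback.fst π (𝒰.f i) x))
    have h2 : π (pullback.fst π (𝒰.f i) x) = 𝒰.f i (pullback.snd π (𝒰.f i) x) := by
      rw [← Scheme.Hom.comp_apply, pullback.condition, Scheme.Hom.comp_apply]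
    rw [Scheme.Hom.comp_apply, h1, h2]
    exact i.2.2 (pullback.snd π (𝒰.f i) x).2
  let m : pullback (pullback.snd π (𝒰.f i)) (pullback.snd π (𝒰.f i)) ⟶ pullback π π :=
    pullback.lift (pullback.fst _ _ ≫ pullback.fst _ _) (pullback.snd _ _ ≫ pullback.fst _ _)
      (by rw [Category.assoc, Category.assoc, pullback.condition, pullback.condition_assoc])
  have hm := congr(m ≫ $hf)
  simp only [m, pullback.lift_fst_assoc, pullback.lift_snd_assoc, Category.assoc] at hm
  have : IsAffine i.1.2.1 := i.1.2.2
  obtain ⟨u, hu⟩ := (hπ.pullback_snd_appTop (𝒰.f i)).exists_comp_eq_of_isAffine f' <| by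
    simp only [← cancel_mono (Scheme.Opens.ι i.1.2.1),
      Category.assoc, IsOpenImmersion.lift_fac, f', hm]
  refine ⟨u ≫ Scheme.Opens.ι _, ?_⟩
  rw [reassoc_of% hu, IsOpenImmersion.lift_fac]

/-- A crisp morphism of affine schemes is a regular epimorphism of schemes. -/
lemma IsCrispRingHom.isRegularEpi_of_isAffine
    {X Y : Scheme.{u}} [IsAffine X] [IsAffine Y] {π : X ⟶ Y} (hπ : IsCrispRingHom π.appTop.hom) :
    IsRegularEpi π := by
  have : Epi π := hπ.epi_of_isAffine
  refine .of_epi_of_exists fun Z f hf ↦ ?_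
  obtain ⟨𝒰, h⟩ := hπ.exists_openCover_exists f hf
  choose u hfac using h
  refine ⟨𝒰.glueMorphisms u ?_, ?_⟩
  · intro i j
    apply (pullback (𝒰.f i) (𝒰.f j)).affineCover.hom_ext
    intro k
    let g := (pullback (𝒰.f i) (𝒰.f j)).affineCover.f k
    -- On an affine piece of the overlap, `u i` and `u j` both become `f` after this epimorphic base
    -- change of `π`.
    have : Epi (pullback.snd π (g ≫ pullback.fst (𝒰.f i) (𝒰.f j) ≫ 𝒰.f i)) :=
      (hπ.pullback_snd_appTop _).epi_of_isAffine
    rw [← cancel_epi (pullback.snd π (g ≫ pullback.fst (𝒰.f i) (𝒰.f j) ≫ 𝒰.f i))]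
    let a := pullback.lift (f := π) (g := 𝒰.f i)
      (pullback.fst π (g ≫ pullback.fst (𝒰.f i) (𝒰.f j) ≫ 𝒰.f i))
      (pullback.snd π (g ≫ pullback.fst (𝒰.f i) (𝒰.f j) ≫ 𝒰.f i) ≫ g ≫ pullback.fst _ _)
      (by simpa using pullback.condition)
    let b := pullback.lift (f := π) (g := 𝒰.f j)
      (pullback.fst π (g ≫ pullback.fst (𝒰.f i) (𝒰.f j) ≫ 𝒰.f i))
      (pullback.snd π (g ≫ pullback.fst (𝒰.f i) (𝒰.f j) ≫ 𝒰.f i) ≫ g ≫ pullback.snd _ _)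
      (by rw [pullback.condition]; simp [pullback.condition])
    have ha := congr(a ≫ $(hfac i))
    have hb := congr(b ≫ $(hfac j))
    simp only [a, b, pullback.lift_fst_assoc, pullback.lift_snd_assoc, Category.assoc] at ha hb
    exact ha.symm.trans hb
  · apply Scheme.Cover.hom_ext (𝒰.pullback₁ π)
    intro (i : 𝒰.I₀)
    change pullback.fst π (𝒰.f i) ≫ π ≫ _ = pullback.fst π (𝒰.f i) ≫ f
    rw [pullback.condition_assoc, Scheme.Cover.ι_glueMorphisms, hfac]

end Descent

/-! ### The crisp topology on schemes and its subcanonicity -/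

section Site

/-- A finite family of flat ring homomorphisms that is jointly surjective on prime spectra is
jointly crisp. -/
lemma isJointlyCrisp_of_flat {A : Type u} [CommRing A] {ι : Type u} [Finite ι] {B : ι → Type u}
    [∀ i, CommRing (B i)] {φ : ∀ i, A →+* B i} (hφ : ∀ i, (φ i).Flat)
    (hs : ∀ p : PrimeSpectrum A, ∃ i, ∃ q : PrimeSpectrum (B i), q.comap (φ i) = p) :
    IsJointlyCrisp φ := by
  rw [← isCrispRingHom_pi_iff.{u, u}]
  apply RingHom.FaithfullyFlat.isCrispRingHom
  rw [RingHom.FaithfullyFlat.iff_flat_and_comap_surjective]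
  constructor
  · cases nonempty_fintype ι
    let (i : ι) : Algebra A (B i) := (φ i).toAlgebra
    have (i : ι) : Module.Flat A (B i) := hφ i
    have : Module.Flat A (∀ i, B i) := .of_linearEquiv DFinsupp.linearEquivFunOnFintype.symm
    exact (RingHom.flat_algebraMap_iff (R := A) (S := ∀ i, B i)).mpr this
  · intro p
    obtain ⟨i, q, rfl⟩ := hs p
    exact ⟨q.comap (Pi.evalRingHom B i), rfl⟩

/-- The crisp topology on the category of schemes: a sieve is covering if its pullback to every
affine scheme contains a finite jointly crisp family of affine schemes. -/
def crispTopology : GrothendieckTopology Scheme.{u} where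
  sieves X := {R | ∀ (A : CommRingCat.{u}) (t : Spec A ⟶ X), ∃ (ι : Type u) (_ : Finite ι)
    (B : ι → CommRingCat.{u}) (φ : ∀ i, A ⟶ B i), IsJointlyCrisp (fun i ↦ (φ i).hom) ∧
      ∀ i, R (Spec.map (φ i) ≫ t)}
  top_mem' X A t := ⟨PUnit, inferInstance, fun _ ↦ A, fun _ ↦ 𝟙 A, isJointlyCrisp_id,
    fun _ ↦ trivial⟩
  pullback_stable' X Y R f hR A t := by
    obtain ⟨ι, hι, B, φ, hφ, h⟩ := hR A (t ≫ f)
    exact ⟨ι, hι, B, φ, hφ, fun i ↦ by simpa using h i⟩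
  transitive' X R hR T hT A t := by
    obtain ⟨ι, hι, B, φ, hφ, h⟩ := hR A t
    choose κ hκ C ψ hψ h' using fun i ↦ hT (h i) (B i) (𝟙 _)
    exact ⟨Σ i, κ i, inferInstance, fun j ↦ C j.1 j.2, fun j ↦ φ j.1 ≫ ψ j.1 j.2, hφ.comp hψ,
      fun j ↦ by simpa using h' j.1 j.2⟩

lemma mem_crispTopology_iff {X : Scheme.{u}} (R : Sieve X) : R ∈ crispTopology X ↔
    ∀ (A : CommRingCat.{u}) (t : Spec A ⟶ X), ∃ (ι : Type u) (_ : Finite ι)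
    (B : ι → CommRingCat.{u}) (φ : ∀ i, A ⟶ B i), IsJointlyCrisp (fun i ↦ (φ i).hom) ∧
      ∀ i, R (Spec.map (φ i) ≫ t) := Iff.rfl

/-- A jointly crisp finite family of ring homomorphisms is covering. -/
lemma mem_crispTopology_of_isJointlyCrisp {A : CommRingCat.{u}} {ι : Type u} [Finite ι]
    {B : ι → CommRingCat.{u}} {φ : ∀ i, A ⟶ B i} (hφ : IsJointlyCrisp (fun i ↦ (φ i).hom))
    {R : Sieve (Spec A)} (hR : ∀ i, R (Spec.map (φ i))) : R ∈ crispTopology (Spec A) := by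
  rw [mem_crispTopology_iff]
  intro A' t
  obtain ⟨ψ, rfl⟩ := Spec.map_surjective t
  let (i : ι) : Algebra A (B i) := (φ i).hom.toAlgebra
  let : Algebra A A' := ψ.hom.toAlgebra
  refine ⟨ι, inferInstance, fun i ↦ .of (A' ⊗[A] B i),
    fun i ↦ CommRingCat.ofHom (algebraMap A' (A' ⊗[A] B i)),
    IsJointlyCrisp.baseChange (B := fun i ↦ B i) hφ A', fun i ↦ ?_⟩
  have : Spec.map (CommRingCat.ofHom (algebraMap A' (A' ⊗[A] B i))) ≫ Spec.map ψ =
      Spec.map (CommRingCat.ofHom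
        (Algebra.TensorProduct.includeRight (R := A) (A := A') (B := B i)).toRingHom) ≫
        Spec.map (φ i) := by
    rw [← Spec.map_comp, ← Spec.map_comp]
    congr 1
    ext a
    exact ((Algebra.TensorProduct.includeLeft (R := A) (S := A) (A := A') (B := B i)).commutes
      a).trans ((Algebra.TensorProduct.includeRight (R := A) (A := A') (B := B i)).commutes a).symm
  rw [this]
  exact R.downward_closed (hR i) _

/-- Quasi-compactness of `Spec A` refines the pulled-back cover to a finite affine one, which is
flat and jointly surjective. -/
lemma mem_crispTopology_of_openCover {X : Scheme.{u}} (𝒰 : X.OpenCover) {R : Sieve X}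
    (hR : ∀ i, R (𝒰.f i)) : R ∈ crispTopology X := by
  rw [mem_crispTopology_iff]
  intro A t
  let 𝒬 : (Spec A).OpenCover := 𝒰.pullback₁ t
  let 𝒲 := 𝒬.affineRefinement.openCover
  have hR' (i) : R (𝒲.f i ≫ t) := by
    obtain ⟨j, k⟩ := i
    have hj : R (𝒬.f j ≫ t) := by
      have : 𝒬.f j ≫ t = pullback.snd t (𝒰.f j) ≫ 𝒰.f j := pullback.condition
      rw [this]
      exact R.downward_closed (hR j) _
    have : 𝒲.f ⟨j, k⟩ ≫ t = (𝒬.X j).affineCover.f k ≫ 𝒬.f j ≫ t := Category.assoc _ _ _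
    rw [this]
    exact R.downward_closed hj _
  let 𝒱 := 𝒲.finiteSubcover
  obtain ⟨n, ⟨e⟩⟩ := Finite.exists_equiv_fin 𝒱.I₀
  have (i : 𝒲.I₀) : IsAffine (𝒲.X i) := inferInstanceAs (IsAffine (Spec _))
  have (i : 𝒱.I₀) : IsAffine (𝒱.X i) :=
    inferInstanceAs (IsAffine (𝒲.finiteSubcover.X i))
  choose φ hφ using fun k : Fin n ↦
    Spec.map_surjective ((𝒱.X (e.symm k)).isoSpec.inv ≫ 𝒱.f (e.symm k))
  refine ⟨ULift (Fin n), inferInstance, _, fun k ↦ φ k.down, ?_, fun ⟨k⟩ ↦ ?_⟩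
  · refine isJointlyCrisp_of_flat (fun ⟨k⟩ ↦ ?_) fun p ↦ ?_
    · rw [← HasRingHomProperty.Spec_iff (P := @Flat), hφ]
      infer_instance
    · obtain ⟨i, x, hx⟩ := 𝒱.exists_eq p
      obtain ⟨k, rfl⟩ := e.symm.surjective i
      refine ⟨⟨k⟩, (𝒱.X (e.symm k)).isoSpec.hom x, ?_⟩
      change Spec.map (φ k) _ = p
      rw [hφ, ← Scheme.Hom.comp_apply, Iso.hom_inv_id_assoc, hx]
  · rw [hφ, Category.assoc]
    exact R.downward_closed (hR' _) _

lemma IsCrispRingHom.specMap_appTop {A B : CommRingCat.{u}} {φ : A ⟶ B}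
    (h : IsCrispRingHom φ.hom) : IsCrispRingHom (Spec.map φ).appTop.hom := by
  have : (Spec.map φ).appTop =
      (Scheme.ΓSpecIso A).hom ≫ φ ≫ (Scheme.ΓSpecIso B).inv := by
    rw [← Scheme.ΓSpecIso_naturality_assoc, Iso.hom_inv_id, Category.comp_id]
  rw [this, CommRingCat.hom_comp, CommRingCat.hom_comp]
  exact (isCrispRingHom_respectsIso.cancel_left_isIso _ _).mpr
    ((isCrispRingHom_respectsIso.cancel_right_isIso _ _).mpr h)

/-- The morphism `Spec (∏ᵢ Bᵢ) ⟶ Spec A` given by a family `A ⟶ Bᵢ`. -/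
noncomputable def specPiMap {A : CommRingCat.{u}} {ι : Type u} {B : ι → CommRingCat.{u}}
    (φ : ∀ i, A ⟶ B i) : Spec (.of (∀ i, B i)) ⟶ Spec A :=
  Spec.map (CommRingCat.ofHom (RingHom.pi fun i ↦ (φ i).hom))

lemma specMap_eval_comp_specPiMap {A : CommRingCat.{u}} {ι : Type u} {B : ι → CommRingCat.{u}}
    (φ : ∀ i, A ⟶ B i) (i : ι) :
    Spec.map (CommRingCat.ofHom (Pi.evalRingHom (fun i ↦ B i) i)) ≫ specPiMap φ =
      Spec.map (φ i) := by
  rw [specPiMap, ← Spec.map_comp]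
  rfl

lemma IsJointlyCrisp.specPiMap_appTop {A : CommRingCat.{u}} {ι : Type u} [Finite ι]
    {B : ι → CommRingCat.{u}} {φ : ∀ i, A ⟶ B i} (hφ : IsJointlyCrisp (fun i ↦ (φ i).hom)) :
    IsCrispRingHom (specPiMap φ).appTop.hom :=
  IsCrispRingHom.specMap_appTop ((isCrispRingHom_pi_iff.{u, u} _).mpr hφ)

lemma mem_zariskiTopology_spec_pi {ι : Type u} [Finite ι] {B : ι → CommRingCat.{u}}
    {R : Sieve (Spec (.of (∀ i, B i)))}
    (hR : ∀ i, R (Spec.map (CommRingCat.ofHom (Pi.evalRingHom (fun i ↦ B i) i)))) :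
    R ∈ Scheme.zariskiTopology (Spec (.of (∀ i, B i))) := by
  rw [← GrothendieckTopology.pullback_mem_iff_of_isIso (i := sigmaSpec B)]
  refine GrothendieckTopology.superset_covering _ ?_
    (sigmaOpenCover (fun i ↦ Spec (B i))).mem_grothendieckTopology
  rw [Sieve.generate_le_iff]
  rintro _ _ ⟨i⟩
  have hi (i : ι) : R (Sigma.ι (fun i ↦ Spec (B i)) i ≫ sigmaSpec B) := by
    rw [ι_sigmaSpec]
    exact hR i
  exact hi i

lemma IsJointlyCrisp.hom_ext {A : CommRingCat.{u}} {ι : Type u} [Finite ι]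
    {B : ι → CommRingCat.{u}} {φ : ∀ i, A ⟶ B i} (hφ : IsJointlyCrisp (fun i ↦ (φ i).hom))
    {Y : Scheme.{u}} {a b : Spec A ⟶ Y} (h : ∀ i, Spec.map (φ i) ≫ a = Spec.map (φ i) ≫ b) :
    a = b := by
  have := hφ.specPiMap_appTop.epi_of_isAffine
  rw [← cancel_epi (specPiMap φ), ← cancel_epi (sigmaSpec B)]
  apply Sigma.hom_ext
  intro k
  rw [ι_sigmaSpec_assoc, ι_sigmaSpec_assoc]
  have := h k
  rwa [← specMap_eval_comp_specPiMap φ k, Category.assoc, Category.assoc] at this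

/-- Morphisms of schemes that agree on a covering sieve for the crisp topology are equal. -/
lemma eq_of_mem_crispTopology {X Y : Scheme.{u}} {R : Sieve X} (hR : R ∈ crispTopology X)
    {a b : X ⟶ Y} (h : ∀ ⦃Z : Scheme.{u}⦄ (g : Z ⟶ X), R g → g ≫ a = g ≫ b) : a = b := by
  apply X.affineCover.hom_ext
  intro i
  obtain ⟨ι, _, B, φ, hφ, hB⟩ := hR _ (X.affineCover.f i)
  exact hφ.hom_ext fun k ↦
    (Category.assoc _ _ _).symm.trans ((h _ (hB k)).trans (Category.assoc _ _ _))

lemma isSeparatedFor_yoneda_of_mem_crispTopology {X : Scheme.{u}} (Y : Scheme.{u}) {R : Sieve X}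
    (hR : R ∈ crispTopology X) : Presieve.IsSeparatedFor (yoneda.obj Y) R.arrows := by
  intro x a b ha hb
  exact eq_of_mem_crispTopology hR fun Z g hg ↦ (ha g hg).trans (hb g hg).symm

/-- The finite family is merged into the regular epimorphism `specPiMap φ`, whose sieve `T`
satisfies descent. To pass from `T` to `R`, note that `R` pulled back to `Spec (∏ᵢ Bᵢ)` contains the
Zariski cover by the factors. -/
lemma isSheafFor_yoneda_of_mem_crispTopology_spec {A : CommRingCat.{u}} (M : Scheme.{u})
    {R : Sieve (Spec A)} (hR : R ∈ crispTopology (Spec A)) :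
    Presieve.IsSheafFor (yoneda.obj M) R.arrows := by
  obtain ⟨ι, _, B, φ, hφ, hB⟩ := hR _ (𝟙 _)
  simp only [Category.comp_id] at hB
  have := hφ.specPiMap_appTop.isRegularEpi_of_isAffine
  let T : Sieve (Spec A) := .generate (.singleton (specPiMap φ))
  have hT : T ∈ crispTopology (Spec A) :=
    mem_crispTopology_of_isJointlyCrisp hφ fun i ↦
      ⟨_, _, _, ⟨⟩, specMap_eval_comp_specPiMap φ i⟩
  refine Presieve.isSheafFor_trans _ T R ?_
    (fun Z f _ ↦ isSeparatedFor_yoneda_of_mem_crispTopology M (crispTopology.pullback_stable f hT))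
    ?_
  · rw [← Presieve.isSheafFor_iff_generate]
    exact .singleton_of_isRepresentable_of_effectiveEpi _ _
  · rintro Z _ ⟨W, g, f, hf, rfl⟩
    obtain ⟨⟩ := hf
    rw [Sieve.pullback_comp]
    refine GrothendieckTopology.Subcanonical.isSheaf_of_isRepresentable
      (J := Scheme.zariskiTopology) (yoneda.obj M) _
      (Scheme.zariskiTopology.pullback_stable g (mem_zariskiTopology_spec_pi fun i ↦ ?_))
    rw [Sieve.pullback_apply, specMap_eval_comp_specPiMap]
    exact hB i

/-- Zariski descent reduces to the sheaf condition on affine opens, with only separatedness needed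
on overlaps. -/
instance subcanonical_crispTopology : crispTopology.{u}.Subcanonical := by
  refine GrothendieckTopology.Subcanonical.of_isSheaf_yoneda_obj _ fun Y X R hR ↦ ?_
  refine X.affineOneHypercover.isSheafFor_of_pullback
    (GrothendieckTopology.Subcanonical.isSheaf_of_isRepresentable _) (fun i ↦ ?_)
    (fun i j k ↦ ?_)
  · rw [Sieve.generate_sieve]
    exact isSheafFor_yoneda_of_mem_crispTopology_spec Y (crispTopology.pullback_stable _ hR)
  · rw [Sieve.generate_sieve]
    exact isSeparatedFor_yoneda_of_mem_crispTopology Y (crispTopology.pullback_stable _ hR)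

end Site

/-! ### Crisp morphisms are the single-morphism coverings of the crisp topology -/

section Comparison

lemma IsJointlyCrisp.exists_comap_eq {A : Type u} [CommRing A] {ι : Type u} [Finite ι]
    {B : ι → Type u} [∀ i, CommRing (B i)] {φ : ∀ i, A →+* B i} (h : IsJointlyCrisp φ)
    (p : PrimeSpectrum A) : ∃ i, ∃ q : PrimeSpectrum (B i), q.comap (φ i) = p := by
  obtain ⟨q, rfl⟩ := ((isCrispRingHom_pi_iff.{u, u} φ).mpr h).comap_surjective p
  obtain ⟨i, q, rfl⟩ := PrimeSpectrum.exists_comap_evalRingHom_eq q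
  exact ⟨i, q, rfl⟩

/-- A compact subset of an open subset of a scheme is covered by finitely many affine opens. -/
lemma exists_finite_affine_cover {X : Scheme.{u}} {C : Set X} (hC : IsCompact C) (U : X.Opens)
    (hCU : C ⊆ U) : ∃ (r : ℕ) (W : Fin r → X.Opens), (∀ i, IsAffineOpen (W i)) ∧
      (∀ i, W i ≤ U) ∧ C ⊆ (⨆ i, W i : X.Opens) := by
  obtain ⟨t, ht⟩ := hC.elim_finite_subcover
    (fun W : {W : X.Opens // IsAffineOpen W ∧ W ≤ U} ↦ (W.1 : Set X)) (fun W ↦ W.1.isOpen) <| by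
    intro x hx
    obtain ⟨_, ⟨W, hW, rfl⟩, hxW, hWU⟩ :=
      X.isBasis_affineOpens.exists_subset_of_mem_open (hCU hx) U.isOpen
    exact Set.mem_iUnion.mpr ⟨⟨W, hW, hWU⟩, hxW⟩
  refine ⟨t.card, fun i ↦ (t.equivFin.symm i).1.1, fun i ↦ (t.equivFin.symm i).1.2.1,
    fun i ↦ (t.equivFin.symm i).1.2.2, fun x hx ↦ ?_⟩
  obtain ⟨W, hW, hxW⟩ := Set.mem_iUnion₂.mp (ht hx)
  rw [SetLike.mem_coe, TopologicalSpace.Opens.mem_iSup]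
  exact ⟨t.equivFin ⟨W, hW⟩, by simpa using hxW⟩

lemma IsLocallyQuasiCompactSurjective.of_affine {X Y : Scheme.{u}} {f : X ⟶ Y}
    (H : ∀ V : Y.Opens, IsAffineOpen V →
      ∃ U : X.Opens, IsCompact (U : Set X) ∧ f '' (U : Set X) = (V : Set Y)) :
    IsLocallyQuasiCompactSurjective f where
  surjective y := by
    obtain ⟨_, ⟨V, hV, rfl⟩, hyV, -⟩ :=
      Y.isBasis_affineOpens.exists_subset_of_mem_open (Set.mem_univ y) isOpen_univ
    obtain ⟨U, -, hU⟩ := H V hV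
    rw [← hU] at hyV
    obtain ⟨x, -, hx⟩ := hyV
    exact ⟨x, hx⟩
  exists_isCompact V hV := by
    refine compact_open_induction_on (P := fun V ↦ ∃ U : X.Opens, IsCompact (U : Set X) ∧
      f '' (U : Set X) = (V : Set Y)) V hV ⟨⊥, by simp, by simp⟩ ?_
    rintro S - V ⟨U, hU, hUS⟩
    obtain ⟨U', hU', hUV⟩ := H V V.2
    refine ⟨U ⊔ U', by simpa using hU.union hU', ?_⟩
    simp [Set.image_union, hUS, hUV]

lemma specMap_appLE_eq_iff {X Y : Scheme.{u}} {f : X ⟶ Y} {V : Y.Opens}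
    (hV : IsAffineOpen V) {W : X.Opens} (hW : IsAffineOpen W) (e : W ≤ f ⁻¹ᵁ V)
    (q : Spec Γ(X, W)) (p : Spec Γ(Y, V)) :
    Spec.map (f.appLE V W e) q = p ↔ f (hW.fromSpec q) = hV.fromSpec p := by
  rw [← hV.fromSpec.isOpenEmbedding.injective.eq_iff, ← Scheme.Hom.comp_apply,
    hV.SpecMap_appLE_fromSpec f hW e, Scheme.Hom.comp_apply]

/-- A flat and locally quasi-compact surjective morphism is crisp. -/
lemma IsCrisp.of_flat {X Y : Scheme.{u}} {f : X ⟶ Y} [Flat f]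
    (hf : IsLocallyQuasiCompactSurjective f) : IsCrisp f where
  locallyQuasiCompactSurjective := hf
  exists_cover V hV := by
    obtain ⟨U, hU, hUV⟩ := hf.exists_isCompact V hV.isCompact
    have hle : U ≤ f ⁻¹ᵁ V := fun x hx ↦ by
      change f x ∈ (V : Set Y)
      rw [← hUV]
      exact ⟨x, hx, rfl⟩
    obtain ⟨r, W, hW, hWU, hUW⟩ := exists_finite_affine_cover hU U subset_rfl
    refine ⟨U, hU, hle, hUV, r, W, fun i ↦ (hWU i).trans hle, hW, le_antisymm (iSup_le hWU) hUW, ?_⟩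
    rw [isCrispRingHom_pi_iff.{u, 0}]
    -- The lift only moves the index set to the required universe; `of_factors` with identities
    -- brings it back.
    refine (isJointlyCrisp_of_flat (ι := ULift.{u} (Fin r))
      (fun i ↦ f.flat_appLE hV (hW i.down) ((hWU i.down).trans hle)) fun p ↦ ?_).of_factors
      fun i ↦ ⟨i.down, RingHom.id _, rfl⟩
    have hp : hV.fromSpec p ∈ (V : Set Y) := by
      rw [← hV.range_fromSpec]; exact ⟨p, rfl⟩
    rw [← hUV] at hp
    obtain ⟨x, hx, hxp⟩ := hp
    obtain ⟨i, hxi⟩ := TopologicalSpace.Opens.mem_iSup.mp (hUW hx)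
    rw [← SetLike.mem_coe, ← (hW i).range_fromSpec] at hxi
    obtain ⟨q, rfl⟩ := hxi
    exact ⟨⟨i⟩, q, (specMap_appLE_eq_iff hV (hW i) _ q p).mpr hxp⟩

lemma mem_crispTopology_of_openCover_pullback {X : Scheme.{u}} (𝒰 : X.OpenCover) {R : Sieve X}
    (hR : ∀ i, R.pullback (𝒰.f i) ∈ crispTopology (𝒰.X i)) : R ∈ crispTopology X := by
  refine crispTopology.transitive (S := .ofArrows 𝒰.X 𝒰.f)
    (mem_crispTopology_of_openCover 𝒰 fun i ↦ Sieve.ofArrows_mk _ _ i) R ?_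
  rintro Z _ ⟨_, g, _, ⟨i⟩, rfl⟩
  rw [Sieve.pullback_comp]
  exact crispTopology.pullback_stable g (hR i)

lemma mem_crispTopology_of_isJointlyCrisp_pullback {A : CommRingCat.{u}} {ι : Type u} [Finite ι]
    {B : ι → CommRingCat.{u}} {φ : ∀ i, A ⟶ B i} (hφ : IsJointlyCrisp (fun i ↦ (φ i).hom))
    {R : Sieve (Spec A)} (hR : ∀ i, R.pullback (Spec.map (φ i)) ∈ crispTopology (Spec (B i))) :
    R ∈ crispTopology (Spec A) := by
  refine crispTopology.transitive (S := .ofArrows (fun i ↦ Spec (B i)) fun i ↦ Spec.map (φ i))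
    (mem_crispTopology_of_isJointlyCrisp hφ fun i ↦ Sieve.ofArrows_mk _ _ i) R ?_
  rintro Z _ ⟨_, g, _, ⟨i⟩, rfl⟩
  rw [Sieve.pullback_comp]
  exact crispTopology.pullback_stable g (hR i)

/-- The cover of a scheme by all its affine opens. -/
noncomputable def allAffineCover (Y : Scheme.{u}) : Y.OpenCover :=
  Scheme.Cover.mkOfCovers Y.affineOpens (fun V ↦ Spec Γ(Y, V)) (fun V ↦ V.2.fromSpec)
    (fun y ↦ by
      obtain ⟨_, ⟨V, hV, rfl⟩, hyV, -⟩ :=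
        Y.isBasis_affineOpens.exists_subset_of_mem_open (Set.mem_univ y) isOpen_univ
      rw [← hV.range_fromSpec] at hyV
      exact ⟨⟨V, hV⟩, hyV⟩)
    (fun V ↦ V.2.isOpenImmersion_fromSpec)

lemma IsCrisp.mem_crispTopology {X Y : Scheme.{u}} {f : X ⟶ Y} (hf : IsCrisp f) :
    Sieve.generate (.singleton f) ∈ crispTopology Y := by
  refine mem_crispTopology_of_openCover_pullback (allAffineCover Y) fun (V : Y.affineOpens) ↦ ?_
  obtain ⟨U, -, -, -, r, W, hWV, hW, -, h⟩ := hf.exists_cover V V.2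
  rw [isCrispRingHom_pi_iff.{u, 0}] at h
  have h' : IsJointlyCrisp fun i : ULift.{u} (Fin r) ↦
      (f.appLE V (W i.down) (hWV i.down)).hom :=
    h.of_factors fun i ↦ ⟨⟨i⟩, RingHom.id _, rfl⟩
  refine mem_crispTopology_of_isJointlyCrisp h' fun i ↦ ?_
  exact ⟨_, (hW i.down).fromSpec, f, ⟨⟩, (V.2.SpecMap_appLE_fromSpec f (hW i.down) _).symm⟩

/-- The `W k` cover the image of each `g i`, so their preimages form a Zariski cover of `Spec (B i)`
whose members factor through the `W k`. Locality for the crisp family `φ` concludes. -/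
lemma mem_crispTopology_of_affine_opens {X Y : Scheme.{u}} {f : X ⟶ Y} {V : Y.Opens}
    (hV : IsAffineOpen V) {r : ℕ} {W : Fin r → X.Opens} (hW : ∀ i, IsAffineOpen (W i))
    (hWV : ∀ i, W i ≤ f ⁻¹ᵁ V) {ι : Type u} [Finite ι] {B : ι → CommRingCat.{u}}
    {φ : ∀ i, Γ(Y, V) ⟶ B i} (hφ : IsJointlyCrisp (fun i ↦ (φ i).hom))
    (g : ∀ i, Spec (B i) ⟶ X) (hg : ∀ i, g i ≫ f = Spec.map (φ i) ≫ hV.fromSpec)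
    (hgW : ∀ i, Set.range (g i) ⊆ (⨆ k, W k : X.Opens)) :
    Sieve.ofArrows (fun k ↦ Spec Γ(X, W k)) (fun k ↦ Spec.map (f.appLE V (W k) (hWV k))) ∈
      crispTopology (Spec Γ(Y, V)) := by
  refine mem_crispTopology_of_isJointlyCrisp_pullback hφ fun i ↦ ?_
  have hcov : TopologicalSpace.IsOpenCover fun k : ULift.{u} (Fin r) ↦ g i ⁻¹ᵁ W k.down := by
    rw [TopologicalSpace.IsOpenCover, eq_top_iff]
    intro x _
    obtain ⟨k, hk⟩ := TopologicalSpace.Opens.mem_iSup.mp (hgW i ⟨x, rfl⟩)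
    exact TopologicalSpace.Opens.mem_iSup.mpr ⟨⟨k⟩, hk⟩
  refine mem_crispTopology_of_openCover ((Spec (B i)).openCoverOfIsOpenCover _ hcov)
    fun (k : ULift.{u} (Fin r)) ↦ ?_
  let l := IsOpenImmersion.lift (hW k.down).fromSpec ((g i ⁻¹ᵁ W k.down).ι ≫ g i) <| by
    rw [(hW k.down).range_fromSpec]
    rintro _ ⟨x, rfl⟩
    exact x.2
  have hl : l ≫ (hW k.down).fromSpec = (g i ⁻¹ᵁ W k.down).ι ≫ g i :=
    IsOpenImmersion.lift_fac _ _ _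
  refine ⟨_, l, _, ⟨k.down⟩, ?_⟩
  change l ≫ _ = (g i ⁻¹ᵁ W k.down).ι ≫ Spec.map (φ i)
  rw [← cancel_mono hV.fromSpec, Category.assoc, Category.assoc,
    hV.SpecMap_appLE_fromSpec f (hW k.down), reassoc_of% hl, hg]

/-- A covering of `V` by finitely many `Spec (B i)` lifts to `X` with quasi-compact image. Finitely
many affine opens in `f⁻¹(V)` contain that image, and their union serves as `U`. -/
lemma IsCrisp.of_mem_crispTopology {X Y : Scheme.{u}} {f : X ⟶ Y}
    (hf : Sieve.generate (.singleton f) ∈ crispTopology Y) : IsCrisp f := by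
  have key (V : Y.Opens) (hV : IsAffineOpen V) : ∃ U : X.Opens, IsCompact (U : Set X) ∧
      U ≤ f ⁻¹ᵁ V ∧ f '' (U : Set X) = (V : Set Y) ∧
      ∃ (r : ℕ) (W : Fin r → X.Opens) (hW : ∀ i, W i ≤ f ⁻¹ᵁ V),
        (∀ i, IsAffineOpen (W i)) ∧ ⨆ i, W i = U ∧
          IsCrispRingHom (RingHom.pi fun i => (f.appLE V (W i) (hW i)).hom) := by
    obtain ⟨ι, _, B, φ, hφ, h⟩ := hf _ hV.fromSpec
    have (i : ι) : ∃ g : Spec (B i) ⟶ X, g ≫ f = Spec.map (φ i) ≫ hV.fromSpec := by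
      obtain ⟨_, g, _, ⟨⟩, h⟩ := h i
      exact ⟨g, h⟩
    choose g hg using this
    have hgV : ⋃ i, Set.range (g i) ⊆ (f ⁻¹ᵁ V : X.Opens) := by
      rw [Set.iUnion_subset_iff]
      rintro i _ ⟨x, rfl⟩
      change f (g i x) ∈ (V : Set Y)
      rw [← Scheme.Hom.comp_apply, hg, ← hV.range_fromSpec]
      exact ⟨_, rfl⟩
    obtain ⟨r, W, hW, hWV, hC⟩ := exists_finite_affine_cover
      (isCompact_iUnion fun i ↦ isCompact_range (g i).continuous) _ hgV
    refine ⟨⨆ i, W i, ?_, iSup_le hWV, subset_antisymm ?_ ?_, r, W, hWV, hW, rfl, ?_⟩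
    · rw [TopologicalSpace.Opens.coe_iSup]
      exact isCompact_iUnion fun i ↦ (hW i).isCompact
    · rintro _ ⟨x, hx, rfl⟩
      exact iSup_le hWV hx
    · intro y hy
      rw [← hV.range_fromSpec] at hy
      obtain ⟨p, rfl⟩ := hy
      obtain ⟨i, q, rfl⟩ := hφ.exists_comap_eq p
      refine ⟨g i q, hC (Set.mem_iUnion.mpr ⟨i, q, rfl⟩), ?_⟩
      exact congr($(hg i) q)
    · rw [isCrispRingHom_pi_iff.{u, 0}]
      obtain ⟨κ, _, E, ψ, hψ, h⟩ := mem_crispTopology_of_affine_opens hV hW hWV hφ g hg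
        (fun i ↦ (Set.subset_iUnion _ i).trans hC) _ (𝟙 _)
      -- Each member of the crisp family refining the sieve factors through some `W k`, so the `W k`
      -- are themselves jointly crisp.
      refine hψ.of_factors fun l ↦ ?_
      obtain ⟨_, a, _, ⟨k⟩, ha⟩ := h l
      obtain ⟨a, rfl⟩ := Spec.map_surjective a
      rw [Category.comp_id, ← Spec.map_comp] at ha
      exact ⟨k, a.hom, congr($(Spec.map_injective ha).hom)⟩
  exact ⟨.of_affine fun V hV ↦ have ⟨U, hU, _, hUV, _⟩ := key V hV; ⟨U, hU, hUV⟩, key⟩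

lemma isCrisp_iff_mem_crispTopology {X Y : Scheme.{u}} (f : X ⟶ Y) :
    IsCrisp f ↔ Sieve.generate (.singleton f) ∈ crispTopology Y :=
  ⟨fun h ↦ h.mem_crispTopology, .of_mem_crispTopology⟩

end Comparison

/-! ### Crisp families over `S` -/

section Pretopology

variable {S : Scheme.{u}}

/-- The sieve of the family and that of the map from the coproduct differ by the Zariski cover of
the coproduct by its summands. -/
lemma isCrisp_sigmaDesc_iff {X : Scheme.{u}} {ι : Type u} {U : ι → Scheme.{u}}
    (f : ∀ i, U i ⟶ X) :
    IsCrisp (Sigma.desc f) ↔ Sieve.ofArrows U f ∈ crispTopology X := by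
  rw [isCrisp_iff_mem_crispTopology]
  refine ⟨fun h ↦ crispTopology.transitive h _ ?_, fun h ↦ crispTopology.superset_covering ?_ h⟩
  · rintro Z _ ⟨_, g, _, ⟨⟩, rfl⟩
    rw [Sieve.pullback_comp]
    refine crispTopology.pullback_stable g
      (mem_crispTopology_of_openCover (sigmaOpenCover U) fun (i : ι) ↦ ?_)
    change Sieve.ofArrows U f (Sigma.ι U i ≫ Sigma.desc f)
    rw [Sigma.ι_desc]
    exact Sieve.ofArrows_mk _ _ i
  · rw [Sieve.ofArrows, Sieve.generate_le_iff]
    rintro _ _ ⟨i⟩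
    exact ⟨_, Sigma.ι U i, _, ⟨⟩, Sigma.ι_desc _ _⟩

lemma overEquiv_generate_ofArrows {X : Over S} {ι : Type u} {U : ι → Over S}
    (f : ∀ i, U i ⟶ X) : Sieve.overEquiv X (Sieve.generate (Presieve.ofArrows U f)) =
      Sieve.ofArrows (fun i ↦ (U i).left) (fun i ↦ (f i).left) := by
  ext Z g
  rw [Sieve.overEquiv_iff]
  constructor
  · rintro ⟨_, h, _, ⟨i⟩, hg⟩
    exact ⟨_, h.left, _, ⟨i⟩, congr(($hg).left)⟩
  · rintro ⟨_, h, _, ⟨i⟩, rfl⟩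
    exact ⟨_, Over.homMk h (by simp), _, ⟨i⟩, by ext; simp⟩

lemma isCrispFamily_iff {X : Over S} {ι : Type u} {U : ι → Over S} (f : ∀ i, U i ⟶ X) :
    IsCrispFamily f ↔
      Presieve.ofArrows U f ∈ (crispTopology.over S).toPretopology X := by
  rw [GrothendieckTopology.mem_toPretopology, GrothendieckTopology.mem_over_iff,
    overEquiv_generate_ofArrows]
  exact isCrisp_sigmaDesc_iff _

/-- Smallness of the indexing is separated from a condition on the set of arrows alone, so the
pretopology axioms reduce to size bookkeeping. -/
lemma mem_crispPrecoverage_iff {X : Over S} (R : Presieve X) :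
    R ∈ (crispPrecoverage S).coverings X ↔
      (∃ (ι : Type u) (U : ι → Over S) (f : ∀ i, U i ⟶ X), R = Presieve.ofArrows U f) ∧
        R ∈ (crispTopology.over S).toPretopology X := by
  constructor
  · rintro ⟨ι, U, f, rfl, h⟩
    exact ⟨⟨ι, U, f, rfl⟩, (isCrispFamily_iff f).mp h⟩
  · rintro ⟨⟨ι, U, f, rfl⟩, h⟩
    exact ⟨ι, U, f, rfl, (isCrispFamily_iff f).mpr h⟩

/-- The pretopology on schemes over `S` given by the crisp coverings. -/
def crispPretopology (S : Scheme.{u}) : Pretopology (Over S) where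
  toPrecoverage := crispPrecoverage S
  has_isos X Y f _ := by
    rw [mem_crispPrecoverage_iff]
    exact ⟨⟨PUnit, _, _, (Presieve.ofArrows_pUnit f).symm⟩, Pretopology.has_isos _ f⟩
  pullbacks X Y f R hR := by
    rw [mem_crispPrecoverage_iff] at hR ⊢
    refine ⟨?_, Pretopology.pullbacks _ f R hR.2⟩
    obtain ⟨⟨ι, U, g, rfl⟩, -⟩ := hR
    exact ⟨ι, _, _, (Presieve.ofArrows_pullback f U g).symm⟩
  transitive X R Ti hR hTi := by
    simp only [mem_crispPrecoverage_iff] at hR hTi ⊢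
    refine ⟨?_, Pretopology.transitive _ R Ti hR.2 fun Y f H ↦ (hTi f H).2⟩
    obtain ⟨⟨ι, U, g, rfl⟩, -⟩ := hR
    choose κ W k hk using fun Y f H ↦ (hTi (Y := Y) f H).1
    obtain rfl : Ti = fun Y f H ↦ Presieve.ofArrows (W Y f H) (k Y f H) := by
      funext Y f H
      exact hk Y f H
    exact ⟨_, _, _, Presieve.ofArrows_bind U g _ _ _⟩

lemma crispPretopology_toGrothendieck_le (S : Scheme.{u}) :
    (crispPretopology S).toGrothendieck ≤ crispTopology.over S := by
  rintro X R ⟨T, hT, hTR⟩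
  exact GrothendieckTopology.superset_covering _ ((Sieve.generate_le_iff _ _).mpr hTR)
    ((mem_crispPrecoverage_iff T).mp hT).2

lemma fpqcPrecoverage_le_crispPrecoverage (S : Scheme.{u}) :
    fpqcPrecoverage S ≤ crispPrecoverage S := by
  rintro X _ ⟨ι, U, f, rfl, hflat, hf⟩
  exact ⟨ι, U, f, rfl, .of_flat hf⟩

end Pretopology

theorem theorem3p6 (S : Scheme.{u}) :
    ∃ K : Pretopology (Over S),
      K.toPrecoverage = crispPrecoverage S ∧
      (∀ (X : Over S) (ι : Type u) (U : ι → Over S) (f : ∀ i, U i ⟶ X),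
        Presieve.ofArrows U f ∈ K X ↔ IsCrispFamily f) ∧
      fpqcPrecoverage S ≤ K.toPrecoverage ∧
      (fpqcPrecoverage S).toGrothendieck ≤ K.toGrothendieck ∧
      K.toGrothendieck.Subcanonical ∧
      ∀ F : (Over S)ᵒᵖ ⥤ Type u, F.IsRepresentable →
        Presieve.IsSheaf K.toGrothendieck F := by
  have hsub : (crispPretopology S).toGrothendieck.Subcanonical :=
    .of_le (crispPretopology_toGrothendieck_le S)
  refine ⟨crispPretopology S, rfl, fun X ι U f ↦ ?_, fpqcPrecoverage_le_crispPrecoverage S, ?_,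
    hsub, fun F _ ↦ GrothendieckTopology.Subcanonical.isSheaf_of_isRepresentable F⟩
  · rw [isCrispFamily_iff]
    exact (mem_crispPrecoverage_iff _).trans (and_iff_right ⟨ι, U, f, rfl⟩)
  · rw [Precoverage.toGrothendieck_le_iff_le_toPrecoverage]
    intro X R hR
    exact ⟨R, fpqcPrecoverage_le_crispPrecoverage S X hR, Sieve.le_generate R⟩
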